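/- All graphs are finite, simple, undirected and have at least one vertex. For a graph $G$ on $n\ge 1$ vertices let $\lambda_n(G)$ denote the least eigenvalue of its adjacency matrix, let $C_t$ denote the cycle on $t$ vertices, and let $K_{a,b}$ denote the complete bipartite graph with parts of sizes $a$ and $b$. A graph is $C_t$-free if it does not contain $C_t$ as a (not necessarily induced) subgraph. Let $t\ge 3$ and let $G$ be a $C_t$-free graph on $n$ vertices. (i) If $t$ is odd or $n<t$, then $\lambda_n(G)\ge -\sqrt{\lfloor n/2\rfloor\lceil n/2\rceil}$, and equality holds if and only if $G\cong K_{\lfloor n/2\rfloor,\lceil n/2\rceil}$. (ii) If $t=2k+2$ for an integer $k$ and $n\ge t$, then $\lambda_n(G)\ge -\sqrt{k(n-k)}$, and equality holds if and only if $G\cong K_{k,n-k}$. -/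

import Mathlib

/-- The least eigenvalue of the adjacency matrix of a finite graph `G` (meaningful when `V` is
nonempty, see `leastEigenvalue_isLeast`). -/
noncomputable def leastEigenvalue {V : Type*} [Fintype V] [DecidableEq V]
    (G : SimpleGraph V) [DecidableRel G.Adj] : ℝ :=
  sInf (spectrum ℝ (G.adjMatrix ℝ))

theorem leastEigenvalue_isLeast {V : Type*} [Fintype V] [DecidableEq V] [Nonempty V]
    (G : SimpleGraph V) [DecidableRel G.Adj] :
    IsLeast (spectrum ℝ (G.adjMatrix ℝ)) (leastEigenvalue G) := by
  have h := (G.isHermitian_adjMatrix ℝ).spectrum_real_eq_range_eigenvalues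
  have hf : (spectrum ℝ (G.adjMatrix ℝ)).Finite := h ▸ Set.finite_range _
  have hn : (spectrum ℝ (G.adjMatrix ℝ)).Nonempty := h ▸ Set.range_nonempty _
  exact ⟨hn.csInf_mem hf, fun _ hx => csInf_le hf.bddBelow hx⟩

/-! Let `x` be an eigenvector for the least eigenvalue `-μ`, and cut the vertices by the sign of
`x`. Edges inside a side only help, so `μ * |x v|` is at most the sum of `|x|` over the neighbours
of `v` across the cut. Applying this twice at a maximum of `|x|` bounds `μ ^ 2` by the number of
two-step walks from that vertex in the bipartite cut graph (`sq_le_of_twoWalks_le`).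

It remains to bound these walks by `k * m`, where `k + m = n`. For balanced `k`, `m` this is the
product of the side sizes. If `C_{2k+2}` is excluded, the walks number `d(v)` plus the edges between
the first and second neighbourhoods of `v`. A path of `2k` edges alternating between these, with
both ends in the first, would close through `v`, so `sum_card_filter_adj_le_of_no_path` limits the
edges.

In the equality case every inequality is tight and `SpansCut` spreads the tightness over the graph
(`adj_iff_of_sq_eq`). -/

open Finset

namespace SimpleGraph

variable {V : Type*}

/-- The bipartite subgraph of `G` formed by the edges between `s` and its complement. -/
def cutGraph (G : SimpleGraph V) (s : Finset V) : SimpleGraph V where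
  Adj u v := G.Adj u v ∧ (u ∈ s ↔ v ∉ s)
  symm := ⟨fun _ _ h => ⟨h.1.symm, by tauto⟩⟩
  loopless := ⟨fun _ h => G.loopless.irrefl _ h.1⟩

instance [DecidableEq V] (G : SimpleGraph V) [DecidableRel G.Adj] (s : Finset V) :
    DecidableRel (G.cutGraph s).Adj :=
  fun u v => inferInstanceAs (Decidable (G.Adj u v ∧ (u ∈ s ↔ v ∉ s)))

theorem cutGraph_adj {G : SimpleGraph V} {s : Finset V} {u v : V} :
    (G.cutGraph s).Adj u v ↔ G.Adj u v ∧ (u ∈ s ↔ v ∉ s) := Iff.rfl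

theorem cutGraph_le (G : SimpleGraph V) (s : Finset V) : G.cutGraph s ≤ G := fun _ _ h => h.1

/-- The number of walks of length two starting at `v`. -/
def twoWalks [Fintype V] (H : SimpleGraph V) [DecidableRel H.Adj] (v : V) : ℕ :=
  ∑ u ∈ H.neighborFinset v, H.degree u

/-- A vertex `v` spans the bipartition given by `s` if it is adjacent to the whole opposite side
and joined by a walk of length two to every vertex of its own side. -/
def SpansCut (H : SimpleGraph V) (s : Finset V) (v : V) : Prop :=
  ∀ w, ((v ∈ s ↔ w ∉ s) → H.Adj v w) ∧ ((v ∈ s ↔ w ∈ s) → ∃ u, H.Adj v u ∧ H.Adj u w)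

/-! ### Alternating paths in bipartite graphs. -/

section Paths

variable (H : SimpleGraph V)

/-- Greedy construction of an alternating path. -/
theorem exists_alternating_path [DecidableEq V] [DecidableRel H.Adj] {A B : Finset V} {k : ℕ}
    (hAB : Disjoint A B) (hA : A.Nonempty)
    (hdA : ∀ a ∈ A, k ≤ #{b ∈ B | H.Adj a b}) (hdB : ∀ b ∈ B, k + 1 ≤ #{a ∈ A | H.Adj a b})
    (m : ℕ) (hm : m ≤ k) :
    ∃ a ∈ A, ∃ a' ∈ A, ∃ p : H.Walk a a', p.IsPath ∧ p.length = 2 * m ∧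
      ∃ S ⊆ A, ∃ T ⊆ B, #S ≤ m + 1 ∧ #T ≤ m ∧ ∀ w ∈ p.support, w ∈ S ∪ T := by
  induction m with
  | zero =>
    obtain ⟨a, ha⟩ := hA
    exact ⟨a, ha, a, ha, Walk.nil, by simp, by simp, {a}, by simpa, ∅, by simp, by simp, by simp,
      by simp⟩
  | succ m ih =>
    obtain ⟨a, ha, a', ha', p, hp, hl, S, hS, T, hT, hSc, hTc, hsup⟩ := ih (by omega)
    -- The path has one more vertex in `A` than in `B`, hence the thresholds `k` and `k + 1`.
    obtain ⟨b, hb, hbT⟩ : ∃ b ∈ ({b ∈ B | H.Adj a b} : Finset V), b ∉ T :=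
      exists_mem_notMem_of_card_lt_card (by have := hdA a ha; omega)
    rw [mem_filter] at hb
    obtain ⟨c, hc, hcS⟩ : ∃ c ∈ ({a ∈ A | H.Adj a b} : Finset V), c ∉ S :=
      exists_mem_notMem_of_card_lt_card (by have := hdB b hb.1; omega)
    rw [mem_filter] at hc
    have hbS : b ∉ S := fun h => Finset.disjoint_left.mp hAB (hS h) hb.1
    have hcT : c ∉ T := fun h => Finset.disjoint_left.mp hAB hc.1 (hT h)
    have hbp : b ∉ p.support := fun h => by
      rcases mem_union.mp (hsup _ h) with h | h <;> contradiction
    have hcp : c ∉ p.support := fun h => by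
      rcases mem_union.mp (hsup _ h) with h | h <;> contradiction
    refine ⟨c, hc.1, a', ha', Walk.cons hc.2 (Walk.cons hb.2.symm p), ?_, ?_,
      insert c S, insert_subset hc.1 hS, insert b T, insert_subset hb.1 hT,
      (card_insert_le _ _).trans (by omega), (card_insert_le _ _).trans (by omega), ?_⟩
    · simp [Walk.cons_isPath_iff, hp, hbp, hcp, hc.2.ne]
    · simp [hl]; ring
    · intro w hw
      simp only [Walk.support_cons, List.mem_cons] at hw
      rcases hw with rfl | rfl | hw
      · simp
      · simp
      · have := hsup w hw
        simp only [mem_union, mem_insert] at this ⊢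
        tauto

theorem sum_card_filter_adj_erase_right [DecidableEq V] [DecidableRel H.Adj] {A B : Finset V} {b : V} (hb : b ∈ B) :
    ∑ a ∈ A, #{x ∈ B | H.Adj a x} =
      #{a ∈ A | H.Adj a b} + ∑ a ∈ A, #{x ∈ B.erase b | H.Adj a x} := by
  rw [card_filter, ← sum_add_distrib]
  refine sum_congr rfl fun a _ => ?_
  rw [card_filter, card_filter, add_sum_erase B (fun x => if H.Adj a x then 1 else 0) hb]

theorem sum_card_filter_adj_le_mul [DecidableRel H.Adj] (A B : Finset V) :
    ∑ a ∈ A, #{b ∈ B | H.Adj a b} ≤ #A * #B := by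
  simpa using sum_le_card_nsmul A (fun a => #{b ∈ B | H.Adj a b}) #B
    fun a _ => card_filter_le _ _

/-- If no path with `2 * j + 3` vertices alternates between `A` and `B` with both ends in `A`, there
are few edges between `A` and `B`. -/
theorem sum_card_filter_adj_le_of_no_path [DecidableEq V] [DecidableRel H.Adj] {j : ℕ} (A B : Finset V) (hAB : Disjoint A B)
    (hA : j + 1 ≤ #A) (hB : j ≤ #B)
    (hno : ∀ a ∈ A, ∀ a' ∈ A, ∀ p : H.Walk a a', p.IsPath → p.length = 2 * (j + 1) →
      ¬ ∀ w ∈ p.support, w ∈ A ∪ B) :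
    ∑ a ∈ A, #{b ∈ B | H.Adj a b} + j * (j + 1) ≤ j * #A + (j + 1) * #B := by
  induction hN : #A + #B generalizing A B with
  | zero => omega
  | succ N ih =>
    have htriv := sum_card_filter_adj_le_mul H A B
    -- At `#A = j + 1` or `#B = j` the claimed bound equals `#A * #B`. Otherwise a vertex of low
    -- degree can be deleted, the bound dropping by `j` or `j + 1`; if there is none, the greedy
    -- path exists.
    rcases hA.eq_or_lt with hA | hA
    · rw [← hA] at htriv ⊢; nlinarith
    rcases hB.eq_or_lt with hB | hB
    · rw [← hB] at htriv ⊢; nlinarith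
    by_cases h1 : ∃ a ∈ A, #{b ∈ B | H.Adj a b} ≤ j
    · obtain ⟨a, ha, hda⟩ := h1
      have hc := card_erase_add_one ha
      have := ih (A.erase a) B (hAB.mono_left (erase_subset _ _)) (by omega) hB.le
        (fun x hx y hy p hp hl hs => hno x (mem_of_mem_erase hx) y (mem_of_mem_erase hy) p hp hl
          fun w hw => union_subset_union_left (erase_subset _ _) (hs w hw)) (by omega)
      rw [← add_sum_erase A _ ha, ← hc]
      nlinarith
    by_cases h2 : ∃ b ∈ B, #{a ∈ A | H.Adj a b} ≤ j + 1
    · obtain ⟨b, hb, hdb⟩ := h2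
      have hc := card_erase_add_one hb
      have := ih A (B.erase b) (hAB.mono_right (erase_subset _ _)) hA.le (by omega)
        (fun x hx y hy p hp hl hs => hno x hx y hy p hp hl
          fun w hw => union_subset_union_right (erase_subset _ _) (hs w hw)) (by omega)
      rw [sum_card_filter_adj_erase_right H hb, ← hc]
      nlinarith
    push Not at h1 h2
    obtain ⟨a, ha, a', ha', p, hp, hl, S, hS, T, hT, -, -, hsup⟩ :=
      exists_alternating_path H (k := j + 1) hAB (card_pos.mp (by omega))
        (fun a ha => h1 a ha) (fun b hb => h2 b hb) (j + 1) le_rfl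
    exact (hno a ha a' ha' p hp hl fun w hw => union_subset_union hS hT (hsup w hw)).elim

variable {H}

/-- A path whose two distinct ends are adjacent to a further vertex closes up to a cycle. -/
theorem cycleGraph_isContained_of_path {a a' v : V} {m : ℕ} (hm : m ≠ 0) (p : H.Walk a a')
    (hp : p.IsPath) (hl : p.length = m) (ha : H.Adj v a) (ha' : H.Adj v a') (hv : v ∉ p.support) :
    (cycleGraph (m + 2)).IsContained H := by
  rw [cycleGraph_isContained_iff (by omega)]
  have hne : a ≠ a' := by
    rintro rfl
    exact hm (hl.symm.trans (Walk.length_eq_zero_iff.mpr (Walk.isPath_iff_nil.mp hp)))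
  refine ⟨a', Walk.cons ha'.symm (Walk.cons ha p), ?_, by simp [hl]⟩
  rw [Walk.cons_isCycle_iff]
  refine ⟨hp.cons hv, ?_⟩
  rw [Walk.edges_cons, List.mem_cons]
  rintro (h | h)
  · rw [Sym2.eq_swap, Sym2.congr_right] at h
    exact hne h.symm
  · exact hv (p.snd_mem_support_of_mem_edges h)

end Paths

/-! ### Counting walks of length two. -/

section TwoWalks

variable [Fintype V] [DecidableEq V] {H : SimpleGraph V} [DecidableRel H.Adj]

variable (H) in
/-- The vertices other than `v` joined to `v` by a walk of length two. -/
def secondNeighborFinset (v : V) : Finset V := {w | w ≠ v ∧ ∃ u, H.Adj v u ∧ H.Adj u w}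

/-- The `degree` term counts the walks that return to `v`. -/
theorem twoWalks_eq_degree_add (v : V) :
    H.twoWalks v = H.degree v +
      ∑ a ∈ H.neighborFinset v, #{b ∈ H.secondNeighborFinset v | H.Adj a b} := by
  rw [← card_neighborFinset_eq_degree, card_eq_sum_ones, ← sum_add_distrib, twoWalks]
  refine sum_congr rfl fun u hu => ?_
  rw [mem_neighborFinset] at hu
  have : H.neighborFinset u = insert v ({b ∈ H.secondNeighborFinset v | H.Adj u b}) := by
    ext w
    simp only [mem_neighborFinset, mem_insert, mem_filter, secondNeighborFinset, mem_univ, true_and]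
    constructor
    · intro h
      by_cases hw : w = v
      · exact Or.inl hw
      · exact Or.inr ⟨⟨hw, u, hu, h⟩, h⟩
    · rintro (rfl | h)
      · exact hu.symm
      · exact h.2
  rw [← card_neighborFinset_eq_degree, this, card_insert_of_notMem (by simp [secondNeighborFinset]),
    add_comm]

theorem mul_lt_mul_of_lt_of_add_le {c d k m : ℕ} (h : c + d ≤ k + m) (hc : c < k) (hkm : k ≤ m) :
    c * d < k * m := by
  obtain ⟨x, rfl⟩ := Nat.exists_eq_add_of_lt hc
  obtain ⟨y, rfl⟩ := Nat.exists_eq_add_of_le hkm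
  have : d ≤ (c + x + 1) + (x + 1) + y := by omega
  nlinarith [Nat.mul_le_mul_left c this]

theorem disjoint_neighborFinset_secondNeighborFinset {s : Finset V}
    (hs : ∀ u v, H.Adj u v → (u ∈ s ↔ v ∉ s)) (v : V) :
    Disjoint (H.neighborFinset v) (H.secondNeighborFinset v) := by
  rw [Finset.disjoint_left]
  intro w hw hw'
  rw [mem_neighborFinset] at hw
  obtain ⟨u, hvu, huw⟩ := (mem_filter.mp hw').2.2
  have := hs _ _ hw
  have := hs _ _ hvu
  have := hs _ _ huw
  tauto

/-- In a bipartite graph without cycles of length `2 * k + 2` there are at most `k * m` walks of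
length two from each vertex, where `k + m` is the number of vertices. -/
theorem twoWalks_le_of_cycleGraph_free {s : Finset V}
    (hs : ∀ u v, H.Adj u v → (u ∈ s ↔ v ∉ s)) {k m : ℕ} (hk : 0 < k) (hkm : k ≤ m)
    (hV : Fintype.card V = k + m) (hfree : (cycleGraph (2 * k + 2)).Free H) (v : V) :
    H.twoWalks v ≤ k * m ∧ (H.twoWalks v = k * m → H.SpansCut s v) := by
  have hdis := disjoint_neighborFinset_secondNeighborFinset hs v
  have hnotin : v ∉ H.neighborFinset v ∪ H.secondNeighborFinset v := by
    simp [secondNeighborFinset]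
  have hcard : #(insert v (H.neighborFinset v ∪ H.secondNeighborFinset v)) =
      #(H.neighborFinset v) + #(H.secondNeighborFinset v) + 1 := by
    rw [card_insert_of_notMem hnotin, card_union_of_disjoint hdis]
  have hle : #(H.neighborFinset v) + #(H.secondNeighborFinset v) + 1 ≤ k + m := by
    rw [← hcard, ← hV]; exact card_le_univ _
  have htriv := sum_card_filter_adj_le_mul H (H.neighborFinset v) (H.secondNeighborFinset v)
  have htw := twoWalks_eq_degree_add (H := H) v
  rw [← card_neighborFinset_eq_degree] at htw
  have htriv' : H.twoWalks v ≤ #(H.neighborFinset v) * (#(H.secondNeighborFinset v) + 1) := by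
    rw [htw]; nlinarith
  -- If either factor of `htriv'` is below `k`, the product is strictly below `k * m` and equality
  -- cannot occur.
  by_cases h1 : #(H.neighborFinset v) < k
  · have := mul_lt_mul_of_lt_of_add_le (by omega) h1 hkm
      (d := #(H.secondNeighborFinset v) + 1)
    exact ⟨by omega, by omega⟩
  by_cases h2 : #(H.secondNeighborFinset v) + 1 < k
  · have := mul_lt_mul_of_lt_of_add_le (by omega) h2 hkm (d := #(H.neighborFinset v))
    rw [mul_comm] at this
    exact ⟨by omega, by omega⟩
  obtain ⟨j, rfl⟩ : ∃ j, k = j + 1 := ⟨k - 1, by omega⟩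
  have hmain := sum_card_filter_adj_le_of_no_path H (j := j) _ _ hdis (by omega) (by omega)
    (fun a ha a' ha' p hp hl hsup => hfree <| cycleGraph_isContained_of_path (v := v) (by omega) p
      hp hl (by simpa using ha) (by simpa using ha') fun hv => hnotin (hsup v hv))
  refine ⟨by rw [htw]; nlinarith, fun heq => ?_⟩
  -- Each vertex missed by the two neighbourhoods costs `j + 1` in the bound.
  have huniv : insert v (H.neighborFinset v ∪ H.secondNeighborFinset v) = univ := by
    rw [← card_eq_iff_eq_univ, hcard, hV]
    by_contra hne
    have : #(H.neighborFinset v) + #(H.secondNeighborFinset v) + 2 ≤ j + 1 + m := by omega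
    nlinarith
  have hcases : ∀ w, w = v ∨ H.Adj v w ∨ ∃ u, H.Adj v u ∧ H.Adj u w := fun w => by
    have hw : w ∈ insert v (H.neighborFinset v ∪ H.secondNeighborFinset v) := by simp [huniv]
    simp only [mem_insert, mem_union, mem_neighborFinset, secondNeighborFinset, mem_filter] at hw
    tauto
  refine fun w => ⟨fun hw => ?_, fun hw => ?_⟩
  · rcases hcases w with rfl | h | ⟨u, h, h'⟩
    · tauto
    · exact h
    · have := hs _ _ h
      have := hs _ _ h'
      tauto
  · rcases hcases w with rfl | h | h
    · obtain ⟨u, hu⟩ : (H.neighborFinset w).Nonempty := card_pos.mp (by omega)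
      rw [mem_neighborFinset] at hu
      exact ⟨u, hu, hu.symm⟩
    · have := hs _ _ h
      tauto
    · exact h

/-- In a bipartite graph there are at most `k * m` walks of length two from each vertex, where
`k` and `m` are the two halves of the number of vertices. -/
theorem twoWalks_le_of_balanced {s : Finset V}
    (hs : ∀ u v, H.Adj u v → (u ∈ s ↔ v ∉ s)) {k m : ℕ} (hk : 0 < k) (hkm : k ≤ m) (hmk : m ≤ k + 1)
    (hV : Fintype.card V = k + m) (v : V) :
    H.twoWalks v ≤ k * m ∧ (H.twoWalks v = k * m → H.SpansCut s v) := by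
  set P : Finset V := {w | w ∈ s ↔ v ∈ s} with hP
  set Q : Finset V := {w | ¬ (w ∈ s ↔ v ∈ s)} with hQ
  have hPQ : #P + #Q = k + m := by
    rw [← hV, ← card_univ]; exact card_filter_add_card_filter_not _
  have hN : H.neighborFinset v ⊆ Q := fun w hw => by
    have := hs _ _ ((mem_neighborFinset _ _ _).mp hw)
    simp only [hQ, mem_filter, mem_univ, true_and]; tauto
  have hN' : ∀ u ∈ H.neighborFinset v, H.neighborFinset u ⊆ P := fun u hu w hw => by
    have := hs _ _ ((mem_neighborFinset _ _ _).mp hu)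
    have := hs _ _ ((mem_neighborFinset _ _ _).mp hw)
    simp only [hP, mem_filter, mem_univ, true_and]; tauto
  have hdeg : ∀ u ∈ H.neighborFinset v, H.degree u ≤ #P := fun u hu => by
    rw [← card_neighborFinset_eq_degree]; exact card_le_card (hN' u hu)
  have h1 : H.twoWalks v ≤ #(H.neighborFinset v) * #P := by
    simpa [twoWalks] using sum_le_card_nsmul _ _ _ hdeg
  have h2 : #(H.neighborFinset v) * #P ≤ #Q * #P := Nat.mul_le_mul_right _ (card_le_card hN)
  have h3 : #Q * #P ≤ k * m := by
    rcases lt_or_ge #Q k with h | h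
    · exact (mul_lt_mul_of_lt_of_add_le (by omega) h hkm).le
    rcases lt_or_ge #P k with h' | h'
    · rw [mul_comm]; exact (mul_lt_mul_of_lt_of_add_le (by omega) h' hkm).le
    rcases h.eq_or_lt with h | h
    · rw [show #P = m by omega, ← h]
    · rw [show #P = k by omega, show #Q = m by omega, mul_comm]
  refine ⟨by omega, fun heq => ?_⟩
  have hpos : 0 < k * m := Nat.mul_pos hk (by omega)
  have hPpos : 0 < #P := Nat.pos_of_ne_zero fun h => by rw [h] at h1; omega
  have hNQ : H.neighborFinset v = Q :=
    eq_of_subset_of_card_le hN (Nat.le_of_mul_le_mul_right (by omega) hPpos)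
  have hall : ∀ u ∈ H.neighborFinset v, H.degree u = #P := by
    refine (sum_eq_sum_iff_of_le hdeg).mp ?_
    rw [sum_const, smul_eq_mul]
    change H.twoWalks v = _
    omega
  obtain ⟨u, hu⟩ : (H.neighborFinset v).Nonempty := by
    rw [nonempty_iff_ne_empty]
    intro h
    rw [h] at h1
    simp at h1
    omega
  have huP : H.neighborFinset u = P :=
    eq_of_subset_of_card_le (hN' u hu) (by rw [card_neighborFinset_eq_degree, hall u hu])
  refine fun w => ⟨fun hw => ?_, fun hw => ⟨u, (mem_neighborFinset _ _ _).mp hu, ?_⟩⟩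
  · rw [← mem_neighborFinset, hNQ]
    simp only [hQ, mem_filter, mem_univ, true_and]; tauto
  · rw [← mem_neighborFinset, huP]
    simp only [hP, mem_filter, mem_univ, true_and]; tauto

end TwoWalks

theorem nonempty_iso_completeBipartiteGraph [Fintype V] [DecidableEq V] {G : SimpleGraph V}
    {s : Finset V}
    (h : ∀ u v, G.Adj u v ↔ (u ∈ s ↔ v ∉ s)) {a b : ℕ} (ha : #s = a) (hb : #sᶜ = b) :
    Nonempty (G ≃g completeBipartiteGraph (Fin a) (Fin b)) := by
  have e₁ : {v // v ∈ s} ≃ Fin a := s.equivFinOfCardEq ha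
  have e₂ : {v // v ∉ s} ≃ Fin b :=
    (Equiv.subtypeEquivRight fun v => by simp).trans (sᶜ.equivFinOfCardEq hb)
  refine ⟨⟨(Equiv.sumCompl fun v => v ∈ s).symm.trans (e₁.sumCongr e₂), fun {u v} => ?_⟩⟩
  rw [h]
  by_cases hu : u ∈ s <;> by_cases hv : v ∈ s <;>
    simp [hu, hv, Equiv.sumCompl_symm_apply_of_pos, Equiv.sumCompl_symm_apply_of_neg]

/-! ### Eigenvectors and the sign cut. -/

section Spectral

variable [Fintype V] [DecidableEq V] (G : SimpleGraph V) [DecidableRel G.Adj]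

theorem mem_spectrum_adjMatrix_iff (c : ℝ) :
    c ∈ spectrum ℝ (G.adjMatrix ℝ) ↔
      ∃ x : V → ℝ, x ≠ 0 ∧ ∀ v, ∑ u ∈ G.neighborFinset v, x u = c * x v := by
  rw [← Matrix.spectrum_toLin', ← Module.End.hasEigenvalue_iff_mem_spectrum]
  have key : ∀ x : V → ℝ, Matrix.toLin' (G.adjMatrix ℝ) x = c • x ↔
      ∀ v, ∑ u ∈ G.neighborFinset v, x u = c * x v := fun x => by
    rw [funext_iff]
    simp [Matrix.toLin'_apply]
  constructor
  · intro h
    obtain ⟨x, hx⟩ := h.exists_hasEigenvector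
    exact ⟨x, hx.2, (key x).mp hx.apply_eq_smul⟩
  · rintro ⟨x, hx0, hx⟩
    exact Module.End.hasEigenvalue_of_hasEigenvector
      (Module.End.hasEigenvector_iff.mpr ⟨Module.End.mem_eigenspace_iff.mpr ((key x).mpr hx), hx0⟩)

section Eigenvector

variable {G} {μ : ℝ} {x : V → ℝ}

/-- For an eigenvector `x`, the eigenvalue equation in terms of `|x|`, with the neighbours sorted by
whether they lie on the same side of the sign cut. -/
theorem mul_abs_add_sum_eq
    (hx : ∀ v, ∑ u ∈ G.neighborFinset v, x u = -μ * x v) (v : V) :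
    μ * |x v| + ∑ u ∈ G.neighborFinset v with ¬ (v ∈ ({w | 0 ≤ x w} : Finset V) ↔
        u ∉ ({w | 0 ≤ x w} : Finset V)), |x u| =
      ∑ u ∈ (G.cutGraph {w | 0 ≤ x w}).neighborFinset v, |x u| := by
  have hN : (G.cutGraph {w | 0 ≤ x w}).neighborFinset v =
      {u ∈ G.neighborFinset v | v ∈ ({w | 0 ≤ x w} : Finset V) ↔
        u ∉ ({w | 0 ≤ x w} : Finset V)} := by
    ext u; rw [mem_neighborFinset, mem_filter, mem_neighborFinset, cutGraph_adj]
  have hsplit := sum_filter_add_sum_filter_not (G.neighborFinset v)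
    (fun u => v ∈ ({w | 0 ≤ x w} : Finset V) ↔ u ∉ ({w | 0 ≤ x w} : Finset V)) x
  rw [hx v] at hsplit
  rw [hN]
  rcases le_or_gt 0 (x v) with hv | hv
  · have h1 := sum_congr (s₁ := {u ∈ G.neighborFinset v | v ∈ ({w | 0 ≤ x w} : Finset V) ↔
        u ∉ ({w | 0 ≤ x w} : Finset V)}) rfl (f := fun u => |x u|) (g := fun u => -x u)
      fun u hu => abs_of_neg (by simpa [hv] using (mem_filter.mp hu).2)
    have h2 := sum_congr (s₁ := {u ∈ G.neighborFinset v | ¬ (v ∈ ({w | 0 ≤ x w} : Finset V) ↔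
        u ∉ ({w | 0 ≤ x w} : Finset V))}) rfl (f := fun u => |x u|) (g := x)
      fun u hu => abs_of_nonneg (by simpa [hv] using (mem_filter.mp hu).2)
    rw [h1, h2, sum_neg_distrib, abs_of_nonneg hv]
    linarith
  · have h1 := sum_congr (s₁ := {u ∈ G.neighborFinset v | v ∈ ({w | 0 ≤ x w} : Finset V) ↔
        u ∉ ({w | 0 ≤ x w} : Finset V)}) rfl (f := fun u => |x u|) (g := x)
      fun u hu => abs_of_nonneg (by simpa [hv.not_ge] using (mem_filter.mp hu).2)
    have h2 := sum_congr (s₁ := {u ∈ G.neighborFinset v | ¬ (v ∈ ({w | 0 ≤ x w} : Finset V) ↔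
        u ∉ ({w | 0 ≤ x w} : Finset V))}) rfl (f := fun u => |x u|) (g := fun u => -x u)
      fun u hu => abs_of_neg (by simpa [hv.not_ge] using (mem_filter.mp hu).2)
    rw [h1, h2, sum_neg_distrib, abs_of_neg hv]
    linarith

theorem mul_abs_le_sum
    (hx : ∀ v, ∑ u ∈ G.neighborFinset v, x u = -μ * x v) (v : V) :
    μ * |x v| ≤ ∑ u ∈ (G.cutGraph {w | 0 ≤ x w}).neighborFinset v, |x u| := by
  rw [← mul_abs_add_sum_eq hx v]
  exact le_add_of_nonneg_right (sum_nonneg fun _ _ => abs_nonneg _)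

/-- At a vertex where `|x|` is maximal, the squared eigenvalue is at most the number of walks of
length two. -/
theorem sq_mul_abs_le
    (hx : ∀ v, ∑ u ∈ G.neighborFinset v, x u = -μ * x v) (hμ : 0 ≤ μ) {v : V} (hv : ∀ w, |x w| ≤ |x v|) :
    μ * (μ * |x v|) ≤ μ * ∑ u ∈ (G.cutGraph {w | 0 ≤ x w}).neighborFinset v, |x u| ∧
    μ * ∑ u ∈ (G.cutGraph {w | 0 ≤ x w}).neighborFinset v, |x u| ≤
      ∑ u ∈ (G.cutGraph {w | 0 ≤ x w}).neighborFinset v,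
        ∑ w ∈ (G.cutGraph {w | 0 ≤ x w}).neighborFinset u, |x w| ∧
    ∑ u ∈ (G.cutGraph {w | 0 ≤ x w}).neighborFinset v,
        ∑ w ∈ (G.cutGraph {w | 0 ≤ x w}).neighborFinset u, |x w| ≤
      (G.cutGraph {w | 0 ≤ x w}).twoWalks v * |x v| := by
  refine ⟨mul_le_mul_of_nonneg_left (mul_abs_le_sum hx v) hμ, ?_, ?_⟩
  · rw [mul_sum]
    exact sum_le_sum fun u _ => mul_abs_le_sum hx u
  · rw [twoWalks, Nat.cast_sum, sum_mul]
    refine sum_le_sum fun u _ => ?_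
    rw [← card_neighborFinset_eq_degree, ← nsmul_eq_mul]
    exact sum_le_card_nsmul _ _ _ fun w _ => hv w

theorem sq_le_of_twoWalks_le
    (hx : ∀ v, ∑ u ∈ G.neighborFinset v, x u = -μ * x v) (hμ : 0 ≤ μ) (hx0 : x ≠ 0) {R : ℕ}
    (hR : ∀ v, (G.cutGraph {w | 0 ≤ x w}).twoWalks v ≤ R) : μ ^ 2 ≤ R := by
  obtain ⟨w, hw⟩ := Function.ne_iff.mp hx0
  have : Nonempty V := ⟨w⟩
  obtain ⟨v, hv⟩ := Finite.exists_max fun v => |x v|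
  have hpos : 0 < |x v| := (abs_pos.mpr hw).trans_le (hv w)
  obtain ⟨h1, h2, h3⟩ := sq_mul_abs_le hx hμ hv
  have h4 : ((G.cutGraph {w | 0 ≤ x w}).twoWalks v : ℝ) ≤ R := by exact_mod_cast hR v
  nlinarith [mul_le_mul_of_nonneg_right h4 hpos.le]

/-- If equality holds in the bound by walks of length two, and walks of length two are only
maximal at spanning vertices, then `G` is complete bipartite. -/
theorem adj_iff_of_sq_eq
    (hx : ∀ v, ∑ u ∈ G.neighborFinset v, x u = -μ * x v) (hμ : 0 < μ) (hx0 : x ≠ 0) {R : ℕ}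
    (hR : ∀ v, (G.cutGraph {w | 0 ≤ x w}).twoWalks v ≤ R)
    (hspan : ∀ v, (G.cutGraph {w | 0 ≤ x w}).twoWalks v = R →
      (G.cutGraph {w | 0 ≤ x w}).SpansCut {w | 0 ≤ x w} v)
    (heq : μ ^ 2 = R) :
    (∀ u v, G.Adj u v ↔ (u ∈ ({w | 0 ≤ x w} : Finset V) ↔ v ∉ ({w | 0 ≤ x w} : Finset V))) ∧
      ∃ v, (G.cutGraph {w | 0 ≤ x w}).twoWalks v = R := by
  obtain ⟨w₀, hw₀⟩ := Function.ne_iff.mp hx0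
  have : Nonempty V := ⟨w₀⟩
  obtain ⟨v, hv⟩ := Finite.exists_max fun v => |x v|
  have hpos : 0 < |x v| := (abs_pos.mpr hw₀).trans_le (hv w₀)
  -- Wherever `|x|` is maximal, the whole chain of `sq_mul_abs_le` collapses to equalities.
  have key : ∀ v', |x v'| = |x v| → (G.cutGraph {w | 0 ≤ x w}).twoWalks v' = R ∧
      μ * |x v'| = ∑ u ∈ (G.cutGraph {w | 0 ≤ x w}).neighborFinset v', |x u| ∧
      ∀ u, (G.cutGraph {w | 0 ≤ x w}).Adj v' u →
        μ * |x u| = ∑ w ∈ (G.cutGraph {w | 0 ≤ x w}).neighborFinset u, |x w| ∧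
        ∀ w, (G.cutGraph {w | 0 ≤ x w}).Adj u w → |x w| = |x v| := by
    intro v' hv'
    obtain ⟨h1, h2, h3⟩ := sq_mul_abs_le hx hμ.le (v := v') (by simpa [hv'] using hv)
    have h4 : ((G.cutGraph {w | 0 ≤ x w}).twoWalks v' : ℝ) ≤ R := by exact_mod_cast hR v'
    have h5 := mul_le_mul_of_nonneg_right h4 (abs_nonneg (x v'))
    have h6 : μ * (μ * |x v'|) = R * |x v'| := by rw [← heq]; ring
    refine ⟨?_, ?_, ?_⟩
    · have : ((G.cutGraph {w | 0 ≤ x w}).twoWalks v' : ℝ) * |x v'| = R * |x v'| := by linarith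
      exact_mod_cast mul_right_cancel₀ (by rw [hv']; exact hpos.ne') this
    · exact mul_left_cancel₀ hμ.ne' (by linarith)
    · intro u hu
      have e1 : ∑ u ∈ (G.cutGraph {w | 0 ≤ x w}).neighborFinset v', μ * |x u| =
          ∑ u ∈ (G.cutGraph {w | 0 ≤ x w}).neighborFinset v',
            ∑ w ∈ (G.cutGraph {w | 0 ≤ x w}).neighborFinset u, |x w| := by
        rw [← mul_sum]; linarith
      have hu' := (mem_neighborFinset _ _ _).mpr hu
      refine ⟨(sum_eq_sum_iff_of_le fun u _ => mul_abs_le_sum hx u).mp e1 u hu', fun w hw => ?_⟩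
      have e2 : ∑ u ∈ (G.cutGraph {w | 0 ≤ x w}).neighborFinset v',
            ∑ w ∈ (G.cutGraph {w | 0 ≤ x w}).neighborFinset u, |x w| =
          ∑ u ∈ (G.cutGraph {w | 0 ≤ x w}).neighborFinset v',
            ∑ w ∈ (G.cutGraph {w | 0 ≤ x w}).neighborFinset u, |x v| := by
        refine le_antisymm (sum_le_sum fun u _ => sum_le_sum fun w _ => hv w) ?_
        simp only [sum_const, nsmul_eq_mul, card_neighborFinset_eq_degree, ← sum_mul]
        rw [← Nat.cast_sum]
        change ((G.cutGraph {w | 0 ≤ x w}).twoWalks v' : ℝ) * _ ≤ _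
        rw [← hv']
        linarith
      have e3 := (sum_eq_sum_iff_of_le fun u _ => sum_le_sum fun w _ => hv w).mp e2 u hu'
      exact (sum_eq_sum_iff_of_le fun w _ => hv w).mp e3 w ((mem_neighborFinset _ _ _).mpr hw)
  have hsv := hspan v (key v rfl).1
  have hsame : ∀ w, (v ∈ ({w | 0 ≤ x w} : Finset V) ↔ w ∈ ({w | 0 ≤ x w} : Finset V)) →
      |x w| = |x v| := fun w hw => by
    obtain ⟨u, hvu, huw⟩ := (hsv w).2 hw
    exact ((key v rfl).2.2 u hvu).2 w huw
  have htight : ∀ u, μ * |x u| = ∑ w ∈ (G.cutGraph {w | 0 ≤ x w}).neighborFinset u, |x w| :=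
    fun u => by
    by_cases hu : v ∈ ({w | 0 ≤ x w} : Finset V) ↔ u ∈ ({w | 0 ≤ x w} : Finset V)
    · exact (key u (hsame u hu)).2.1
    · exact ((key v rfl).2.2 u ((hsv u).1 (by tauto))).1
  have hall : ∀ u, 0 < |x u| := fun u => by
    by_cases hu : v ∈ ({w | 0 ≤ x w} : Finset V) ↔ u ∈ ({w | 0 ≤ x w} : Finset V)
    · rw [hsame u hu]; exact hpos
    · have hadj := (hsv u).1 (by tauto)
      have : |x v| ≤ μ * |x u| := by
        rw [htight u]
        exact single_le_sum (f := fun w => |x w|) (fun _ _ => abs_nonneg _)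
          ((mem_neighborFinset _ _ _).mpr hadj.symm)
      exact pos_of_mul_pos_right (hpos.trans_le this) hμ.le
  refine ⟨fun u w => ⟨fun hadj => ?_, fun hcut => ?_⟩, v, (key v rfl).1⟩
  -- An edge inside a side would add a positive term to an identity that is already tight.
  · by_contra hne
    have h := mul_abs_add_sum_eq hx u
    rw [← htight u, add_eq_left, sum_eq_zero_iff_of_nonneg fun _ _ => abs_nonneg _] at h
    exact (hall w).ne' (h w (mem_filter.mpr ⟨(mem_neighborFinset _ _ _).mpr hadj, hne⟩))
  -- One end of a cut pair lies on the side of `v`, where `|x|` is maximal and hence every vertex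
  -- spans.
  · by_cases hu : v ∈ ({w | 0 ≤ x w} : Finset V) ↔ u ∈ ({w | 0 ≤ x w} : Finset V)
    · exact ((hspan u (key u (hsame u hu)).1 w).1 hcut).1
    · exact ((hspan w (key w (hsame w (by tauto))).1 u).1 (by tauto)).1.symm

end Eigenvector

variable {G}

/-- Gives the product of the part sizes, from which they are recovered in the equality case. -/
theorem twoWalks_cutGraph_of_adj_iff {s : Finset V}
    (h : ∀ u v, G.Adj u v ↔ (u ∈ s ↔ v ∉ s)) (v : V) :
    (G.cutGraph s).twoWalks v = #s * #sᶜ := by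
  have hin : ∀ u ∈ s, (G.cutGraph s).neighborFinset u = sᶜ := fun u hu => by
    ext w; simp only [mem_neighborFinset, cutGraph_adj, mem_compl, h, hu, true_iff, and_self]
  have hout : ∀ u, u ∉ s → (G.cutGraph s).neighborFinset u = s := fun u hu => by
    ext w; simp only [mem_neighborFinset, cutGraph_adj, h, hu, false_iff, not_not, and_self]
  simp only [twoWalks, ← card_neighborFinset_eq_degree]
  by_cases hv : v ∈ s
  · rw [hin v hv, sum_congr rfl fun u hu => by rw [hout u (mem_compl.mp hu)]]
    simp [mul_comm]
  · rw [hout v hv, sum_congr rfl fun u hu => by rw [hin u hu]]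
    simp

/-- `-√(a * b)` is an eigenvalue of the complete bipartite graph with parts of sizes `a`, `b`. -/
theorem neg_sqrt_mem_spectrum_of_iso {a b : ℕ} (hb : 0 < b) (ha : 0 < a)
    (e : G ≃g completeBipartiteGraph (Fin a) (Fin b)) :
    -√((a : ℝ) * b) ∈ spectrum ℝ (G.adjMatrix ℝ) := by
  classical
  have hsum : ∀ (y : Fin a ⊕ Fin b → ℝ) (v : V), ∑ u ∈ G.neighborFinset v, y (e u) =
      ∑ z, if (completeBipartiteGraph (Fin a) (Fin b)).Adj (e v) z then y z else 0 := fun y v => by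
    rw [← e.toEquiv.sum_comp, neighborFinset_eq_filter, sum_filter]
    refine sum_congr rfl fun u _ => ?_
    have : (completeBipartiteGraph (Fin a) (Fin b)).Adj (e v) (e u) ↔ G.Adj v u := e.map_adj_iff
    simp only [← this]
    rfl
  have hsa := Real.mul_self_sqrt (Nat.cast_nonneg (α := ℝ) a)
  have hsb := Real.mul_self_sqrt (Nat.cast_nonneg (α := ℝ) b)
  rw [mem_spectrum_adjMatrix_iff]
  refine ⟨fun v => Sum.elim (fun _ => √(b : ℝ)) (fun _ => -√(a : ℝ)) (e v), ?_, fun v => ?_⟩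
  · refine Function.ne_iff.mpr ⟨e.symm (Sum.inl ⟨0, ha⟩), ?_⟩
    have : (0 : ℝ) < b := by exact_mod_cast hb
    simp [(Real.sqrt_pos.mpr this).ne']
  · rw [hsum, Real.sqrt_mul (Nat.cast_nonneg a)]
    rcases hev : e v with i | i
    · simp only [hev, completeBipartiteGraph_adj, Fintype.sum_sum_type]
      simp
      linear_combination (-√(a : ℝ)) * hsb
    · simp only [hev, completeBipartiteGraph_adj, Fintype.sum_sum_type]
      simp
      linear_combination (-√(b : ℝ)) * hsa

/-- If every cut of `G` has at most `a * b` walks of length two from each vertex, where `a + b` is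
the number of vertices, with equality only at spanning vertices, then the least eigenvalue is at
least `-√(a * b)`, with equality only for the complete bipartite graph. -/
theorem leastEigenvalue_of_twoWalks_le [Nonempty V] {a b : ℕ} (ha : 0 < a) (hb : 0 < b)
    (hV : Fintype.card V = a + b)
    (hcut : ∀ s v, (G.cutGraph s).twoWalks v ≤ a * b ∧
      ((G.cutGraph s).twoWalks v = a * b → (G.cutGraph s).SpansCut s v)) :
    -√((a : ℝ) * b) ≤ leastEigenvalue G ∧
      (leastEigenvalue G = -√((a : ℝ) * b) ↔
        Nonempty (G ≃g completeBipartiteGraph (Fin a) (Fin b))) := by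
  have hleast := leastEigenvalue_isLeast G
  obtain ⟨x, hx0, hx⟩ := (mem_spectrum_adjMatrix_iff G _).mp hleast.1
  have hx' : ∀ v, ∑ u ∈ G.neighborFinset v, x u = -(-leastEigenvalue G) * x v := by simpa using hx
  have hab : (0 : ℝ) < a * b := by positivity
  have hbound : -√((a : ℝ) * b) ≤ leastEigenvalue G := by
    rw [neg_le]
    rcases le_or_gt 0 (-leastEigenvalue G) with h | h
    · refine Real.le_sqrt_of_sq_le ?_
      exact_mod_cast sq_le_of_twoWalks_le hx' h hx0 fun v => (hcut _ v).1
    · exact h.le.trans (Real.sqrt_nonneg _)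
  refine ⟨hbound, fun heq => ?_, fun ⟨e⟩ => ?_⟩
  · have hμ : -leastEigenvalue G = √((a : ℝ) * b) := by rw [heq, neg_neg]
    obtain ⟨hadj, v, hv⟩ := adj_iff_of_sq_eq hx' (by rw [hμ]; exact Real.sqrt_pos.mpr hab) hx0
      (fun v => (hcut _ v).1) (fun v => (hcut _ v).2)
      (by rw [hμ, Real.sq_sqrt hab.le]; norm_cast)
    generalize ({w | 0 ≤ x w} : Finset V) = s at hadj hv
    rw [twoWalks_cutGraph_of_adj_iff hadj] at hv
    have hc : #s + #sᶜ = a + b := by rw [card_add_card_compl, hV]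
    -- `#s` and `#sᶜ` have the same sum and product as `a` and `b`.
    have hfac : ((#s : ℤ) - a) * (#s - b) = 0 := by
      have h1 : (#s : ℤ) + #sᶜ = a + b := by exact_mod_cast hc
      have h2 : (#s : ℤ) * #sᶜ = a * b := by exact_mod_cast hv
      linear_combination (#s : ℤ) * h1 - h2
    rcases mul_eq_zero.mp hfac with h | h
    · exact nonempty_iso_completeBipartiteGraph hadj (by omega) (by omega)
    · refine nonempty_iso_completeBipartiteGraph (s := sᶜ) (fun u v => ?_) (by omega)
        (by rw [compl_compl]; omega)
      rw [hadj]
      simp only [mem_compl]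
      tauto
  · exact le_antisymm (hleast.2 (neg_sqrt_mem_spectrum_of_iso hb ha e)) hbound

theorem leastEigenvalue_eq_zero_of_subsingleton [Nonempty V] [Subsingleton V] :
    leastEigenvalue G = 0 := by
  obtain ⟨x, hx0, hx⟩ := (mem_spectrum_adjMatrix_iff G _).mp (leastEigenvalue_isLeast G).1
  obtain ⟨v, hv⟩ := Function.ne_iff.mp hx0
  have hN : G.neighborFinset v = ∅ := by
    ext u
    simp [Subsingleton.elim u v]
  have := hx v
  rw [hN, sum_empty, zero_eq_mul] at this
  exact this.resolve_right hv

end Spectral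

end SimpleGraph

/-! ### Assembling the two cases. -/

theorem Nat.ceil_cast_div_two (n : ℕ) : ⌈(n : ℝ) / 2⌉₊ = n - n / 2 := by
  rcases n.even_or_odd' with ⟨m, rfl | rfl⟩
  · rw [show ((2 * m : ℕ) : ℝ) / 2 = m by push_cast; ring, Nat.ceil_natCast]
    omega
  · rw [show 2 * m + 1 - (2 * m + 1) / 2 = m + 1 by omega, Nat.ceil_eq_iff (by omega)]
    constructor <;> push_cast [Nat.add_sub_cancel] <;> linarith

theorem theorem1p3 {V : Type*} [Fintype V] [DecidableEq V] [Nonempty V]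
    (G : SimpleGraph V) [DecidableRel G.Adj] (n t : ℕ) (hn : Fintype.card V = n) (ht : 3 ≤ t)
    (hG : (SimpleGraph.cycleGraph t).Free G) :
    (Odd t ∨ n < t →
      -√((⌊(n : ℝ) / 2⌋₊ : ℝ) * (⌈(n : ℝ) / 2⌉₊ : ℝ)) ≤ leastEigenvalue G ∧
      (leastEigenvalue G = -√((⌊(n : ℝ) / 2⌋₊ : ℝ) * (⌈(n : ℝ) / 2⌉₊ : ℝ)) ↔
        Nonempty (G ≃g completeBipartiteGraph (Fin ⌊(n : ℝ) / 2⌋₊) (Fin ⌈(n : ℝ) / 2⌉₊)))) ∧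
    (∀ k : ℕ, t = 2 * k + 2 → t ≤ n →
      -√((k : ℝ) * ((n : ℝ) - (k : ℝ))) ≤ leastEigenvalue G ∧
      (leastEigenvalue G = -√((k : ℝ) * ((n : ℝ) - (k : ℝ))) ↔
        Nonempty (G ≃g completeBipartiteGraph (Fin k) (Fin (n - k))))) := by
  have hcutcol : ∀ (s : Finset V) (u v : V), (G.cutGraph s).Adj u v → (u ∈ s ↔ v ∉ s) :=
    fun _ _ _ h => h.2
  have hpos : 0 < n := hn ▸ Fintype.card_pos
  constructor
  · intro _
    rw [Nat.ceil_cast_div_two, Nat.floor_div_ofNat, Nat.floor_natCast]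
    -- For `n = 1` the smaller part is empty, so the general bound with positive parts does not
    -- apply.
    rcases (show 1 ≤ n from hpos).eq_or_lt with h1 | h1
    · subst h1
      have : Subsingleton V := Fintype.card_le_one_iff_subsingleton.mp hn.le
      have h0 : leastEigenvalue G = 0 := SimpleGraph.leastEigenvalue_eq_zero_of_subsingleton
      refine ⟨by simp [h0], fun _ => ?_, fun _ => by simp [h0]⟩
      exact SimpleGraph.nonempty_iso_completeBipartiteGraph (s := ∅)
        (fun u v => by simp [Subsingleton.elim u v]) (by simp) (by simp [hn])
    · exact SimpleGraph.leastEigenvalue_of_twoWalks_le (by omega) (by omega) (by omega) fun s v =>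
        SimpleGraph.twoWalks_le_of_balanced (hcutcol s) (by omega) (by omega) (by omega) (by omega) v
  · rintro k rfl hkn
    rw [← Nat.cast_sub (by omega : k ≤ n)]
    exact SimpleGraph.leastEigenvalue_of_twoWalks_le (by omega) (by omega) (by omega) fun s v =>
      SimpleGraph.twoWalks_le_of_cycleGraph_free (hcutcol s) (by omega) (by omega) (by omega)
        (fun h => hG (h.mono_right (G.cutGraph_le s))) v
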